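/- For a semigroup $S$, let $S^1$ be $S$ with an identity $1$ adjoined. If $S$ has no zero, put $\mathbb{P}(a)=S$ for every $a\in S$. If $S$ has a zero $0$, put $\mathbb{P}(0)=\{0\}$ and, for $a\neq 0$, $\mathbb{P}(a)=\{g\in S : cg\neq 0 \text{ for all } c\in S^1a\setminus\{0\}\}$. Elements $a,b\in S$ are called conjugate, $a\sim_c b$, if there are $g\in\mathbb{P}(a)\cup\{1\}$ and $h\in\mathbb{P}(b)\cup\{1\}$ with $ag=gb$ and $bh=ha$. This is an equivalence relation on $S$, and its classes are called the conjugacy classes of $S$. Let $P(X)$ be the monoid of partial transformations of a set $X$, with mappings written on the right and composed from left to right, and let $\Gamma(X)$ be its subsemigroup of all injective $\alpha$ with $\mathrm{dom}(\alpha)=X$. An element $\gamma\in P(X)$ is connected if its domain is nonempty and for all $x,y\in\mathrm{dom}(\gamma)\cup\mathrm{im}(\gamma)$ there are integers $k,m\geq 0$ such that $x\gamma^k$ and $y\gamma^m$ are both defined and $x\gamma^k=y\gamma^m$ (where $\gamma^0=\mathrm{id}_X$). Theorem. Let $X$ be an infinite set with $|X|=\aleph_\varepsilon$, where $\varepsilon$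 is an ordinal, and let $\kappa=\aleph_0+|\varepsilon|$. Then there are exactly $\kappa^{\aleph_0}$ conjugacy classes in $\Gamma(X)$. Of these, exactly two have a connected representative if $\aleph_\varepsilon=\aleph_0$, and none has a connected representative if $\aleph_\varepsilon>\aleph_0$. -/

import Mathlib

open Cardinal

universe u

/-! ### Conjugacy in an arbitrary semigroup -/

namespace SemigroupConj

variable {S : Type u} [Semigroup S]

/-- `z` is a zero of the semigroup `S`. (There is at most one such `z`.) -/
def IsZeroElt (z : S) : Prop := ∀ s : S, z * s = z ∧ s * z = z

/-- The left principal ideal `S¹a = {m a : m ∈ S¹}` as a subset of `S`,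
where `S¹ = WithOne S` is `S` with an identity adjoined. -/
def leftIdeal (a : S) : Set S := {c | ∃ m : WithOne S, (c : WithOne S) = m * (a : WithOne S)}

/-- The set `ℙ(a)`. If `S` has no zero, it is all of `S`. If `S` has a zero `0`, then
`ℙ(0) = {0}`, and for `a ≠ 0` it is the set of all `g` such that `c g ≠ 0` for all
`c ∈ S¹a \ {0}`. -/
def conjugators (a : S) : Set S :=
  {g | ∀ z : S, IsZeroElt z →
    (a = z → g = z) ∧ (a ≠ z → ∀ c ∈ leftIdeal a, c ≠ z → c * g ≠ z)}

/-- The set `ℙ¹(a) = ℙ(a) ∪ {1}`, a subset of `S¹`. -/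
def conjugatorsOne (a : S) : Set (WithOne S) :=
  insert 1 ((fun g : S => (g : WithOne S)) '' conjugators a)

/-- Conjugacy `a ∼ b`: there are `g ∈ ℙ¹(a)` and `h ∈ ℙ¹(b)` with `a g = g b` and `b h = h a`. -/
def Conj (a b : S) : Prop :=
  ∃ g ∈ conjugatorsOne a, ∃ h ∈ conjugatorsOne b,
    (a : WithOne S) * g = g * (b : WithOne S) ∧ (b : WithOne S) * h = h * (a : WithOne S)

theorem mul_mem_conjugatorsOne {a b : S} {g h : WithOne S} (hg : g ∈ conjugatorsOne a)
    (hh : h ∈ conjugatorsOne b) (hab : (a : WithOne S) * g = g * (b : WithOne S)) :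
    g * h ∈ conjugatorsOne a := by
  rcases hg with rfl | ⟨g, hg, rfl⟩
  · have : a = b := WithOne.coe_inj.1 (by simpa using hab)
    subst this
    simpa using hh
  · rcases hh with rfl | ⟨h, hh, rfl⟩
    · rw [mul_one]; exact Or.inr ⟨g, hg, rfl⟩
    · have hab' : a * g = g * b := WithOne.coe_inj.1 (by simpa using hab)
      refine Or.inr ⟨g * h, fun z hz => ⟨fun haz => ?_, fun haz c hc hcz => ?_⟩, by simp⟩
      · rw [(hg z hz).1 haz]; exact (hz h).1
      · have h1 : c * g ≠ z := (hg z hz).2 haz c hc hcz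
        obtain ⟨m, hm⟩ := hc
        have h2 : ((c * g : S) : WithOne S) = (m * g) * b := by
          rw [WithOne.coe_mul, hm, mul_assoc, hab, mul_assoc]
        have hbz : b ≠ z := by
          rintro rfl
          apply (hg b hz).2 haz a ⟨1, by simp⟩ haz
          rw [hab']; exact (hz g).2
        rw [← mul_assoc]
        exact (hh z hz).2 hbz _ ⟨_, h2⟩ h1

/-- Conjugacy is an equivalence relation on every semigroup. -/
def conjSetoid (S : Type u) [Semigroup S] : Setoid S where
  r := Conj
  iseqv :=
    { refl := fun a => ⟨1, Or.inl rfl, 1, Or.inl rfl, by simp, by simp⟩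
      symm := fun ⟨g, hg, h, hh, h1, h2⟩ => ⟨h, hh, g, hg, h2, h1⟩
      trans := by
        rintro a b c ⟨g, hg, h, hh, h1, h2⟩ ⟨g', hg', h', hh', h1', h2'⟩
        refine ⟨g * g', mul_mem_conjugatorsOne hg hg' h1, h' * h,
          mul_mem_conjugatorsOne hh' hh h2', ?_, ?_⟩
        · rw [← mul_assoc, h1, mul_assoc, h1', mul_assoc]
        · rw [← mul_assoc, h2', mul_assoc, h2, mul_assoc] }

/-- The type of all conjugacy classes of `S`. -/
def Classes (S : Type u) [Semigroup S] : Type u := Quotient (conjSetoid S)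

/-- The conjugacy class of an element. -/
def classOf (a : S) : Classes S := Quotient.mk (conjSetoid S) a

end SemigroupConj

/-! ### Partial transformations and injective full transformations -/

/-- The set `P(X)` of partial transformations of `X`. -/
def PTrans (X : Type u) : Type u := X →. X

namespace PTrans

variable {X : Type u}

/-- A partial transformation as a partial function. -/
def toPFun (α : PTrans X) : X →. X := α

/-- `α.Maps x y` says that `x` is in the domain of `α` and `x α = y`. -/
def Maps (α : PTrans X) (x y : X) : Prop := y ∈ α.toPFun x

theorem ext_maps {α β : PTrans X} (h : ∀ x y, α.Maps x y ↔ β.Maps x y) : α = β :=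
  PFun.ext h

/-- `P(X)` is a monoid under composition. Mappings are written on the right: `x (α β) = (x α) β`. -/
instance : Monoid (PTrans X) where
  mul α β := PFun.comp β.toPFun α.toPFun
  one := PFun.id X
  mul_assoc α β γ := (PFun.comp_assoc γ.toPFun β.toPFun α.toPFun).symm
  one_mul α := PFun.comp_id α.toPFun
  mul_one α := PFun.id_comp α.toPFun

theorem maps_mul {α β : PTrans X} {x z : X} :
    (α * β).Maps x z ↔ ∃ y, α.Maps x y ∧ β.Maps y z :=
  Part.mem_bind_iff

theorem maps_one {x y : X} : (1 : PTrans X).Maps x y ↔ y = x :=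
  Part.mem_some_iff

/-- The domain of a partial transformation. -/
def dom (α : PTrans X) : Set X := {x | ∃ y, α.Maps x y}

/-- The image of a partial transformation. -/
def im (α : PTrans X) : Set X := {y | ∃ x, α.Maps x y}

/-- The span `dom(α) ∪ im(α)`. -/
def span (α : PTrans X) : Set X := α.dom ∪ α.im

/-- `γ` is connected: `γ ≠ 0` (its domain is not empty), and for all `x, y ∈ span(γ)` there are
`k, m ≥ 0` such that `x γ^k` and `y γ^m` are defined and equal (where `γ^0 = id`). -/
def IsConnected (γ : PTrans X) : Prop :=
  γ.dom.Nonempty ∧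
    ∀ x ∈ γ.span, ∀ y ∈ γ.span, ∃ (k m : ℕ) (z : X), (γ ^ k).Maps x z ∧ (γ ^ m).Maps y z

end PTrans

/-- `Γ(X)`: the subsemigroup of `P(X)` of all injective transformations with domain `X`. -/
def InjTrans (X : Type u) : Subsemigroup (PTrans X) where
  carrier := {α | α.dom = Set.univ ∧ ∀ x y z, α.Maps x z → α.Maps y z → x = y}
  mul_mem' := by
    rintro α β ⟨hα, iα⟩ ⟨hβ, iβ⟩
    refine ⟨Set.eq_univ_of_forall fun x => ?_, fun x y z hx hy => ?_⟩
    · obtain ⟨y, hy⟩ : x ∈ α.dom := hα ▸ Set.mem_univ x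
      obtain ⟨z, hz⟩ : y ∈ β.dom := hβ ▸ Set.mem_univ y
      exact ⟨z, PTrans.maps_mul.2 ⟨y, hy, hz⟩⟩
    · obtain ⟨x', hx, hx'⟩ := PTrans.maps_mul.1 hx
      obtain ⟨y', hy, hy'⟩ := PTrans.maps_mul.1 hy
      have := iβ _ _ _ hx' hy'
      subst this
      exact iα _ _ _ hx hy

/-- The conjugacy classes in `Γ(X)` that have a connected representative. -/
def connectedClasses (X : Type u) : Set (SemigroupConj.Classes (InjTrans X)) :=
  {c | ∃ α : InjTrans X, SemigroupConj.classOf α = c ∧ (α : PTrans X).IsConnected}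

/-! For infinite `X` the semigroup `Γ(X)` has no zero, so `ℙ(a)` is everything, and two injective
self-maps are conjugate exactly when each embeds equivariantly in the other
(`InjTrans.classOf_eq_iff`). The components of an injective self-map are finite cycles, rays and
lines. Upper bound: by `SelfMap.Embeds.of_card_components`, the numbers of components of each period
(0 for rays and lines), and of those inside the range, determine the class. These are countably many
cardinals at most `ℵ_ε`, each with `κ` possible values. Lower bound: cycle numbers can be prescribed
freely once `|X|` rays are added, and embeddings preserve minimal periods, so they are class
invariants. A connected map on an infinite set lives on a countable set and is a ray or a line; a
ray embeds in a line, but not conversely. -/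

open Function

/-! ### Equivariant embeddings of injective self-maps -/

namespace SelfMap

universe v

/-- `f` embeds in `g` if there is an injective map intertwining them. -/
def Embeds {X : Type u} {Y : Type v} (f : X → X) (g : Y → Y) : Prop :=
  ∃ F : X → Y, Injective F ∧ Semiconj F f g

variable {X : Type u} {Y : Type v} {f : X → X} {g : Y → Y}

/-- Two families of base points with the same relations between their forward orbits, the first
of which meets every component, give rise to an embedding. -/
theorem Embeds.of_basepoints (hf : Injective f) (hg : Injective g) {I : Type*}
    (r : I → X) (r' : I → Y) (cover : ∀ x, ∃ i k m, f^[k] x = f^[m] (r i))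
    (rel : ∀ i j m n, f^[m] (r i) = f^[n] (r j) ↔ g^[m] (r' i) = g^[n] (r' j))
    (back : ∀ i k m, f^[m] (r i) ∈ Set.range f^[k] → g^[m] (r' i) ∈ Set.range g^[k]) :
    Embeds f g := by
  -- `F x` is the point reached from `r' (i x)` by `m x` steps forward and `k x` steps back; `back`
  -- makes it exist, and `key` shows that the choices do not matter.
  choose i k m h using cover
  choose F hF using fun x => back (i x) (k x) (m x) ⟨x, h x⟩
  have shift : ∀ (a b : ℕ) (x : X), f^[a] (f^[b] x) = f^[a + b] x := fun a b x =>
    (iterate_add_apply f a b x).symm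
  have shift' : ∀ (a b : ℕ) (y : Y), g^[a] (g^[b] y) = g^[a + b] y := fun a b y =>
    (iterate_add_apply g a b y).symm
  have key : ∀ x j a b, f^[a] x = f^[b] (r j) → g^[a] (F x) = g^[b] (r' j) := by
    intro x j a b hab
    have h1 : f^[a + m x] (r (i x)) = f^[k x + b] (r j) := by
      rw [← shift, ← h, ← shift, ← hab, shift, shift, Nat.add_comm]
    apply (hg.iterate (k x))
    rw [shift' _ b, ← (rel _ _ _ _).1 h1, ← shift' a, ← hF, shift', shift', Nat.add_comm]
  refine ⟨F, fun x y hxy => ?_, fun x => ?_⟩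
  · have h1 : g^[k y + m x] (r' (i x)) = g^[k x + m y] (r' (i y)) := by
      rw [← shift', ← hF, ← shift', ← hF, hxy, shift', shift', Nat.add_comm]
    have h2 := (rel _ _ _ _).2 h1
    rw [← shift, ← h, ← shift, ← h, shift, shift, Nat.add_comm] at h2
    exact (hf.iterate _) h2
  · have h1 := key x (i (f x)) (k (f x) + 1) (m (f x)) (by rw [← h, iterate_succ_apply])
    rw [← hF, iterate_succ_apply] at h1
    exact (hg.iterate _ h1).symm

/-- Minimal period 0 marks a non-periodic point, and congruence modulo 0 is equality, so cycles and
infinite orbits are treated together. -/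
theorem iterate_eq_iterate_iff (hf : Injective f) (x : X) (m n : ℕ) :
    f^[m] x = f^[n] x ↔ (m : ℤ) ≡ n [ZMOD minimalPeriod f x] := by
  wlog h : m ≤ n generalizing m n
  · rw [eq_comm, this n m (le_of_not_ge h)]
    exact Int.modEq_comm
  obtain ⟨d, rfl⟩ := Nat.exists_eq_add_of_le h
  rw [iterate_add_apply, (hf.iterate m).eq_iff, Int.modEq_iff_dvd, eq_comm]
  simpa [Int.natCast_dvd_natCast, IsPeriodicPt, IsFixedPt] using
    isPeriodicPt_iff_minimalPeriod_dvd (f := f) (x := x) (n := d)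

/-! ### Components and their roots -/

/-- Two points are in the same component if their forward orbits meet. -/
def componentSetoid (f : X → X) : Setoid X where
  r x y := ∃ k m, f^[k] x = f^[m] y
  iseqv :=
    { refl := fun _ => ⟨0, 0, rfl⟩
      symm := fun ⟨k, m, h⟩ => ⟨m, k, h.symm⟩
      trans := by
        rintro x y z ⟨k, m, h⟩ ⟨a, b, h'⟩
        refine ⟨a + k, m + b, ?_⟩
        rw [iterate_add_apply, h, ← iterate_add_apply, Nat.add_comm, iterate_add_apply, h',
          ← iterate_add_apply] }

/-- The type of components of a self-map. -/
def Component (f : X → X) : Type u := Quotient (componentSetoid f)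

/-- The component of a point. -/
def component (f : X → X) (x : X) : Component f := Quotient.mk (componentSetoid f) x

theorem component_eq_iff {x y : X} : component f x = component f y ↔ ∃ k m, f^[k] x = f^[m] y :=
  Quotient.eq (r := componentSetoid f)

/-- With this choice, a root in the range certifies that the whole component lies in the range. -/
theorem exists_root (q : Component f) :
    ∃ r, component f r = q ∧ (r ∈ Set.range f → ∀ x, component f x = q → x ∈ Set.range f) := by
  by_cases h : ∃ x, component f x = q ∧ x ∉ Set.range f
  · obtain ⟨x, hx, hxr⟩ := h
    exact ⟨x, hx, fun h => absurd h hxr⟩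
  · push Not at h
    obtain ⟨x, hx⟩ := Quotient.exists_rep q
    exact ⟨x, hx, fun _ => h⟩

/-- A point of a component, chosen outside the range of the self-map if possible. -/
noncomputable def root (q : Component f) : X := (exists_root q).choose

theorem component_root (q : Component f) : component f (root q) = q := (exists_root q).choose_spec.1

theorem mem_range_of_root {q : Component f} (h : root q ∈ Set.range f) {x : X}
    (hx : component f x = q) : x ∈ Set.range f :=
  (exists_root q).choose_spec.2 h x hx

theorem component_iterate (n : ℕ) (x : X) : component f (f^[n] x) = component f x :=
  component_eq_iff.2 ⟨0, n, rfl⟩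

theorem mem_range_iterate_of_root {q : Component f} (h : root q ∈ Set.range f) (k : ℕ) {x : X}
    (hx : component f x = q) : x ∈ Set.range f^[k] := by
  induction k generalizing x with
  | zero => exact ⟨x, rfl⟩
  | succ k ih =>
    obtain ⟨y, rfl⟩ := mem_range_of_root h hx
    obtain ⟨z, rfl⟩ := ih (x := y) ((component_iterate 1 y).symm.trans hx)
    exact ⟨z, iterate_succ_apply' f k z⟩

/-- An injection of components that respects the periods of the components, and the property of
having no point outside the range, gives rise to an embedding. -/
theorem Embeds.of_components (hf : Injective f) (hg : Injective g)
    (φ : Component f → Component g) (hφ : Injective φ)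
    (per : ∀ q, minimalPeriod g (root (φ q)) = minimalPeriod f (root q))
    (src : ∀ q, root q ∈ Set.range f → root (φ q) ∈ Set.range g) : Embeds f g := by
  refine Embeds.of_basepoints hf hg (fun q : Component f => root q) (fun q => root (φ q))
    (fun x => ⟨component f x, component_eq_iff.1 (component_root _).symm⟩) (fun i j m n => ?_)
    (fun q k m h => ?_)
  · by_cases hij : i = j
    · subst hij
      rw [iterate_eq_iterate_iff hf, iterate_eq_iterate_iff hg, per]
    · refine iff_of_false (fun h => hij ?_) (fun h => hij (hφ ?_))
      · rw [← component_root i, ← component_root j]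
        exact component_eq_iff.2 ⟨m, n, h⟩
      · rw [← component_root (φ i), ← component_root (φ j)]
        exact component_eq_iff.2 ⟨m, n, h⟩
  -- For `k ≤ m` the preimage lies on the forward orbit. For `k > m`, cancelling `m` steps puts the
  -- root in the range, and then one can go back indefinitely.
  · rcases le_or_gt k m with hkm | hkm
    · obtain ⟨d, rfl⟩ := Nat.exists_eq_add_of_le hkm
      exact ⟨_, (iterate_add_apply g k d _).symm⟩
    · obtain ⟨d, rfl⟩ := Nat.exists_eq_add_of_lt hkm
      obtain ⟨x, hx⟩ := h
      have : root q ∈ Set.range f := by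
        rw [add_assoc, iterate_add_apply] at hx
        rw [← hf.iterate _ hx, iterate_succ_apply']
        exact ⟨_, rfl⟩
      exact mem_range_iterate_of_root (src q this) _ (by rw [component_iterate, component_root])

end SelfMap

/-- Sets `A`, `B` with subsets of the same cardinalities: there is an injection respecting the
subsets. -/
theorem Cardinal.exists_injective_mapsTo {A B : Type u} (Z : Set A) (W : Set B) (hAB : #A = #B)
    (hZW : #Z = #W) : ∃ φ : A → B, Injective φ ∧ ∀ a ∈ Z, φ a ∈ W := by
  classical
  -- If `W` is as large as `B`, everything fits into `W`. Otherwise `W` is smaller than `B`, which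
  -- forces the complements to be equinumerous.
  rcases le_or_gt #B #W with h | h
  · obtain ⟨e⟩ : Nonempty (A ↪ W) := by rw [← Cardinal.le_def, hAB]; exact h
    exact ⟨fun a => e a, fun a b hab => e.injective (Subtype.ext hab), fun a _ => (e a).2⟩
  · have hc : #(Zᶜ : Set A) = #(Wᶜ : Set B) := by
      rcases finite_or_infinite A with hA | hA
      · exact mk_compl_eq_mk_compl_finite hAB hZW
      · have hB : Infinite B := by rwa [infinite_iff, ← hAB, ← infinite_iff]
        rw [mk_compl_of_infinite W h, mk_compl_of_infinite Z (by rwa [hZW, hAB]), hAB]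
    obtain ⟨e⟩ := Cardinal.eq.1 hZW
    obtain ⟨e'⟩ := Cardinal.eq.1 hc
    refine ⟨((Equiv.Set.sumCompl Z).symm.trans ((e.sumCongr e').trans (Equiv.Set.sumCompl W))),
      Equiv.injective _, fun a ha => ?_⟩
    simp [Equiv.Set.sumCompl_symm_apply_of_mem ha]

/-! ### Embeddings from component counts -/

namespace SelfMap

variable {X : Type u} {Y : Type u} {f : X → X} {g : Y → Y}

/-- The components of a given period. -/
def componentsOfPeriod (f : X → X) (n : ℕ) : Set (Component f) :=
  {q | minimalPeriod f (root q) = n}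

/-- The components of a given period that are contained in the range. -/
def surjComponentsOfPeriod (f : X → X) (n : ℕ) : Set (componentsOfPeriod f n) :=
  {q | root q.1 ∈ Set.range f}

theorem Embeds.of_card_components (hf : Injective f) (hg : Injective g)
    (h : ∀ n, #(componentsOfPeriod f n) = #(componentsOfPeriod g n))
    (h' : ∀ n, #(surjComponentsOfPeriod f n) = #(surjComponentsOfPeriod g n)) : Embeds f g := by
  choose φ hφ hφ' using fun n => Cardinal.exists_injective_mapsTo _ _ (h n) (h' n)
  let P : (q : Component f) → componentsOfPeriod f (minimalPeriod f (root q)) := fun q => ⟨q, rfl⟩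
  have inj : ∀ (m n : ℕ) (a : componentsOfPeriod f m) (b : componentsOfPeriod f n),
      (φ m a : Component g) = φ n b → (a : Component f) = b := by
    intro m n a b hab
    obtain rfl : m = n := by rw [← (φ m a).2, ← (φ n b).2, hab]
    exact congrArg _ (hφ m (Subtype.ext hab))
  exact Embeds.of_components hf hg (fun q => φ _ (P q)) (fun q q' hq => inj _ _ _ _ hq)
    (fun q => (φ _ (P q)).2) (fun q hq => hφ' _ (P q) hq)

end SelfMap

/-! ### Transport and invariants of embeddings -/

namespace SelfMap

universe v w

theorem Embeds.trans {X : Type u} {Y : Type v} {Z : Type w} {f : X → X} {g : Y → Y} {h : Z → Z} :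
    Embeds f g → Embeds g h → Embeds f h :=
  fun ⟨F, hF, hF'⟩ ⟨G, hG, hG'⟩ => ⟨G ∘ F, hG.comp hF, hG'.comp_left hF'⟩

theorem embeds_conj {X : Type u} {Y : Type v} (e : X ≃ Y) (f : X → X) : Embeds f (e.conj f) :=
  ⟨e, e.injective, e.semiconj_conj f⟩

theorem conj_embeds {X : Type u} {Y : Type v} (e : X ≃ Y) (f : X → X) : Embeds (e.conj f) f :=
  ⟨e.symm, e.symm.injective, fun x => by simp⟩

theorem injective_conj {X : Type u} {Y : Type v} (e : X ≃ Y) {f : X → X} (hf : Injective f) :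
    Injective (e.conj f) := by
  exact e.injective.comp (hf.comp e.symm.injective)

theorem Embeds.card_minimalPeriod_le {X Y : Type u} {f : X → X} {g : Y → Y} (h : Embeds f g)
    (n : ℕ) : #{x | minimalPeriod f x = n} ≤ #{y | minimalPeriod g y = n} := by
  obtain ⟨F, hF, hF'⟩ := h
  have hper : ∀ x, minimalPeriod g (F x) = minimalPeriod f x := fun x => by
    rw [minimalPeriod_eq_minimalPeriod_iff]
    intro k
    rw [IsPeriodicPt, IsFixedPt, ← hF'.iterate_right k x, hF.eq_iff, IsPeriodicPt, IsFixedPt]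
  exact mk_le_of_injective (f := fun x => ⟨F x.1, (hper x.1).trans x.2⟩)
    fun x y hxy => Subtype.ext (hF (congrArg Subtype.val hxy))

/-! ### A self-map with prescribed numbers of cycles -/

variable (A : ℕ → Type u) (B : Type u)

/-- A set of cycles, with `A n` indexing those of length `n + 1`, and of rays indexed by `B`. -/
abbrev CyclesAndRays : Type u := (Σ n : ℕ, A n × ZMod (n + 1)) ⊕ (B × ℕ)

variable {A B}

/-- Moving each point of a disjoint union of cycles and rays one step forward. -/
def step : CyclesAndRays A B → CyclesAndRays A B
  | .inl ⟨n, a, i⟩ => .inl ⟨n, a, i + 1⟩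
  | .inr (b, k) => .inr (b, k + 1)

theorem step_injective : Injective (step (A := A) (B := B)) := by
  rintro (⟨n, a, i⟩ | ⟨b, k⟩) (⟨n', a', i'⟩ | ⟨b', k'⟩) h
  · simp only [step, Sum.inl.injEq, Sigma.mk.injEq] at h
    obtain ⟨rfl, h⟩ := h
    simpa using h
  · simp [step] at h
  · simp [step] at h
  · simpa [step] using h

theorem step_iterate_inl (n : ℕ) (a : A n) (i : ZMod (n + 1)) (k : ℕ) :
    step^[k] (.inl ⟨n, a, i⟩ : CyclesAndRays A B) = .inl ⟨n, a, i + k⟩ := by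
  induction k with
  | zero => simp
  | succ k ih => rw [iterate_succ_apply', ih]; simp [step, add_assoc]

theorem step_iterate_inr (b : B) (i k : ℕ) :
    step^[k] (.inr (b, i) : CyclesAndRays A B) = .inr (b, i + k) := by
  induction k with
  | zero => simp
  | succ k ih => rw [iterate_succ_apply', ih]; simp [step, add_assoc]

theorem minimalPeriod_eq_of_forall_dvd {X : Type u} {f : X → X} {x : X} {d : ℕ}
    (h : ∀ k, IsPeriodicPt f k x ↔ d ∣ k) : minimalPeriod f x = d :=
  Nat.dvd_antisymm ((h d).2 dvd_rfl).minimalPeriod_dvd ((h _).1 (isPeriodicPt_minimalPeriod f x))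

theorem minimalPeriod_step_inl (p : Σ n : ℕ, A n × ZMod (n + 1)) :
    minimalPeriod step (.inl p : CyclesAndRays A B) = p.1 + 1 := by
  obtain ⟨n, a, i⟩ := p
  refine minimalPeriod_eq_of_forall_dvd fun k => ?_
  rw [IsPeriodicPt, IsFixedPt, step_iterate_inl, ← ZMod.natCast_eq_zero_iff]
  simp

theorem minimalPeriod_step_inr (p : B × ℕ) :
    minimalPeriod step (.inr p : CyclesAndRays A B) = 0 := by
  obtain ⟨b, i⟩ := p
  refine minimalPeriod_eq_of_forall_dvd fun k => ?_
  rw [IsPeriodicPt, IsFixedPt, step_iterate_inr]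
  simp

theorem card_minimalPeriod_step (n : ℕ) :
    #{y : CyclesAndRays A B | minimalPeriod step y = n + 1} = #(A n) * (n + 1 : ℕ) := by
  have h : #(A n × ZMod (n + 1)) = #(A n) * (n + 1 : ℕ) := by
    rw [mk_prod, mk_fintype (ZMod (n + 1)), ZMod.card]
    simp
  rw [← h, eq_comm]
  refine Cardinal.mk_congr (Equiv.ofBijective
    (fun p => ⟨.inl ⟨n, p⟩, minimalPeriod_step_inl (A := A) ⟨n, p⟩⟩) ⟨fun p q hpq => ?_, ?_⟩)
  · simpa using hpq
  · rintro ⟨⟨m, p⟩ | p, hp⟩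
    · obtain rfl : m = n := by
        simpa only [Set.mem_ofPred_eq, minimalPeriod_step_inl, Nat.add_right_cancel_iff] using hp
      exact ⟨p, rfl⟩
    · rw [Set.mem_ofPred_eq, minimalPeriod_step_inr] at hp
      omega

/-- The rays absorb the cycles, so the cycle numbers do not affect the size. -/
theorem mk_cyclesAndRays (hB : ℵ₀ ≤ #B) (hA : ∀ n, #(A n) ≤ #B) : #(CyclesAndRays A B) = #B := by
  apply le_antisymm
  · have h1 : #(Σ n : ℕ, A n × ZMod (n + 1)) ≤ #B := by
      have h (n : ℕ) : #(A n × ZMod (n + 1)) ≤ #B := by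
        have h' : lift.{u} #(ZMod (n + 1)) ≤ #B :=
          (lift_le_aleph0.2 mk_le_aleph0).trans hB
        rw [mk_prod, lift_uzero]
        exact (mul_le_mul' (hA n) h').trans_eq (mul_eq_self hB)
      rw [mk_sigma]
      refine (sum_le_sum _ _ h).trans ?_
      simp [aleph0_mul_eq hB]
    have h2 : #(B × ℕ) ≤ #B := by simp [mul_aleph0_eq hB]
    calc #(CyclesAndRays A B) = #(Σ n : ℕ, A n × ZMod (n + 1)) + #(B × ℕ) := by simp
      _ ≤ #B + #B := add_le_add h1 h2
      _ = #B := add_eq_self hB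
  · exact mk_le_of_injective (f := fun b => .inr (b, 0)) fun b b' h => by simpa using h

/-! ### Self-maps with a single component -/

section Connected

variable {X : Type u} {Y : Type v} {f : X → X} {g : Y → Y}

theorem minimalPeriod_eq_zero_of_subsingleton_component [Infinite X] (hf : Injective f)
    [Subsingleton (Component f)] (x : X) : minimalPeriod f x = 0 := by
  by_contra h
  have hN : 0 < minimalPeriod f x := Nat.pos_of_ne_zero h
  refine not_finite_iff_infinite.2 ‹Infinite X› (Finite.of_surjective
    (fun j : Fin (minimalPeriod f x) => f^[j] x) fun y => ?_)
  obtain ⟨k, m, hkm⟩ := component_eq_iff.1 (Subsingleton.elim (component f y) (component f x))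
  -- Adding a multiple of the period to `m` does not change the iterate of `x`, and makes the
  -- exponent large enough to cancel `k`.
  have hk : k ≤ minimalPeriod f x * k + m :=
    (Nat.le_mul_of_pos_left k hN).trans (Nat.le_add_right _ _)
  obtain ⟨d, hd⟩ := Nat.exists_eq_add_of_le hk
  refine ⟨⟨d % minimalPeriod f x, Nat.mod_lt _ hN⟩, ?_⟩
  apply hf.iterate k
  simp only
  rw [iterate_mod_minimalPeriod_eq, ← iterate_add_apply, ← hd, hkm, Nat.add_comm,
    iterate_add_apply, ((isPeriodicPt_minimalPeriod f x).mul_const k).eq]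

theorem Embeds.of_subsingleton_component [Infinite X] [Infinite Y] (hf : Injective f)
    (hg : Injective g) [Subsingleton (Component f)] [Subsingleton (Component g)]
    (h : Surjective f → Surjective g) : Embeds f g := by
  refine Embeds.of_components hf hg (fun _ => component g (Classical.arbitrary Y))
    (fun _ _ _ => Subsingleton.elim _ _) (fun q => ?_) fun q hq => h ?_ _
  · rw [minimalPeriod_eq_zero_of_subsingleton_component hf,
      minimalPeriod_eq_zero_of_subsingleton_component hg]
  · exact fun x => mem_range_of_root hq (Subsingleton.elim _ _)

theorem Embeds.surjective [Nonempty X] [Subsingleton (Component g)] (hg : Injective g)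
    (h : Embeds f g) (hf : Surjective f) : Surjective g := by
  obtain ⟨F, hF, hF'⟩ := h
  intro y
  obtain ⟨x⟩ := ‹Nonempty X›
  obtain ⟨a, b, hab⟩ := component_eq_iff.1 (Subsingleton.elim (component g y) (component g (F x)))
  -- Of the `a + 1` steps back, `a` cancel against `f^[a]`, and the last one supplies the preimage
  -- of `y`.
  obtain ⟨x', rfl⟩ := hf.iterate (a + 1) x
  refine ⟨g^[b] (F x'), hg.iterate a ?_⟩
  rw [hab, (hF'.iterate_right _).eq, ← iterate_succ_apply' g, ← iterate_add_apply,
    ← iterate_add_apply]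
  exact congrArg (fun n => g^[n] (F x')) (by omega)

theorem subsingleton_component_iff :
    Subsingleton (Component f) ↔ ∀ x y, ∃ k m, f^[k] x = f^[m] y := by
  refine ⟨fun h x y => component_eq_iff.1 (Subsingleton.elim _ _), fun h => ⟨?_⟩⟩
  rintro ⟨x⟩ ⟨y⟩
  exact component_eq_iff.2 (h x y)

/-- Relative to a base point, `y` is determined by the two exponents at which the orbits meet. -/
theorem countable_of_subsingleton_component (hf : Injective f) [Subsingleton (Component f)] :
    Countable X := by
  rcases isEmpty_or_nonempty X with _ | ⟨⟨x⟩⟩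
  · infer_instance
  choose k m h using fun y => subsingleton_component_iff.1 ‹Subsingleton (Component f)› y x
  refine Injective.countable (f := fun y => (k y, m y)) fun y z hyz => ?_
  simp only [Prod.mk.injEq] at hyz
  have := h y
  rw [hyz.1, hyz.2, ← h z] at this
  exact hf.iterate _ this

theorem subsingleton_component_conj (e : X ≃ Y) [Subsingleton (Component f)] :
    Subsingleton (Component (e.conj f)) := by
  rw [subsingleton_component_iff]
  intro x y
  obtain ⟨k, m, h⟩ := component_eq_iff.1
    (Subsingleton.elim (component f (e.symm x)) (component f (e.symm y)))
  have := congrArg e h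
  rw [((e.semiconj_conj f).iterate_right _).eq, ((e.semiconj_conj f).iterate_right _).eq] at this
  exact ⟨k, m, by simpa using this⟩

theorem subsingleton_component_nat_succ : Subsingleton (Component Nat.succ) :=
  subsingleton_component_iff.2 fun x y =>
    ⟨y, x, by rw [Nat.succ_iterate, Nat.succ_iterate, Nat.add_comm]⟩

theorem subsingleton_component_int_succ : Subsingleton (Component fun i : ℤ => i + 1) :=
  subsingleton_component_iff.2 fun x y => by
    -- By truncation, only the smaller of the two points moves.
    refine ⟨(y - x).toNat, (x - y).toNat, ?_⟩
    simp only [add_right_iterate, nsmul_eq_mul]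
    omega

end Connected

end SelfMap

/-! ### Cardinals up to a given aleph -/

/-- An index type for the cardinals that are at most `ℵ_ ε`. -/
abbrev CardinalIndex (ε : Ordinal.{u}) : Type u := ℕ ⊕ (Order.succ ε).ToType

namespace CardinalIndex

variable {ε : Ordinal.{u}}

/-- The cardinal with a given index. -/
noncomputable def val : CardinalIndex ε → Cardinal.{u}
  | .inl n => n
  | .inr t => aleph (Ordinal.ToType.toOrd t)

theorem val_injective : Injective (val (ε := ε)) := by
  rintro (m | s) (n | t) h
  · simpa [val] using h
  · exact absurd h (natCast_lt_aleph0.trans_le (aleph0_le_aleph _)).ne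
  · exact absurd h (natCast_lt_aleph0.trans_le (aleph0_le_aleph _)).ne'
  · have : (Ordinal.ToType.toOrd s : Ordinal) = Ordinal.ToType.toOrd t := aleph.injective h
    exact congrArg Sum.inr (Ordinal.ToType.mk.symm.injective (Subtype.ext this))

theorem val_le (k : CardinalIndex ε) : k.val ≤ aleph ε := by
  rcases k with n | t
  · exact (natCast_lt_aleph0).le.trans (aleph0_le_aleph _)
  · exact aleph_le_aleph.2 (Order.lt_succ_iff.1 (Ordinal.ToType.toOrd t).2)

theorem exists_val_eq {c : Cardinal.{u}} (hc : c ≤ aleph ε) : ∃ k : CardinalIndex ε, k.val = c := by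
  rcases lt_or_ge c ℵ₀ with h | h
  · obtain ⟨n, rfl⟩ := lt_aleph0.1 h
    exact ⟨.inl n, rfl⟩
  · obtain ⟨o, rfl⟩ := mem_range_aleph_iff.2 h
    exact ⟨.inr (Ordinal.ToType.mk ⟨o, Order.lt_succ_iff.2 (aleph_le_aleph.1 hc)⟩), by simp [val]⟩

theorem mk_eq : #(CardinalIndex ε) = ℵ₀ + ε.card := by
  rw [mk_sum, mk_toType, Order.succ_eq_add_one, Ordinal.card_add_one, add_comm ε.card, lift_uzero,
    ← add_assoc]
  simp

end CardinalIndex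

/-! ### Injective transformations as functions -/

namespace InjTrans

variable {X : Type u}

/-- The function underlying an injective full transformation. -/
noncomputable def toFun (α : InjTrans X) (x : X) : X :=
  (α.2.1.symm ▸ Set.mem_univ x : x ∈ (α : PTrans X).dom).choose

theorem maps_iff {α : InjTrans X} {x y : X} : (α : PTrans X).Maps x y ↔ (toFun α) x = y := by
  have h : (α : PTrans X).Maps x (toFun α x) :=
    (α.2.1.symm ▸ Set.mem_univ x : x ∈ (α : PTrans X).dom).choose_spec
  exact ⟨fun hy => Part.mem_unique h hy, fun hy => hy ▸ h⟩

theorem toFun_injective (α : InjTrans X) : Injective (toFun α) := fun x y h =>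
  α.2.2 x y _ (maps_iff.2 h) (maps_iff.2 rfl)

theorem ext_toFun {α β : InjTrans X} (h : ∀ x, (toFun α) x = (toFun β) x) : α = β :=
  Subtype.ext (PTrans.ext_maps fun x y => by rw [maps_iff, maps_iff, h])

theorem toFun_mul (α β : InjTrans X) (x : X) : toFun (α * β) x = (toFun β) (toFun α x) :=
  maps_iff.1 (PTrans.maps_mul.2 ⟨_, maps_iff.2 rfl, maps_iff.2 rfl⟩)

theorem maps_pow (α : InjTrans X) (k : ℕ) (x y : X) :
    ((α : PTrans X) ^ k).Maps x y ↔ (toFun α)^[k] x = y := by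
  induction k generalizing y with
  | zero => rw [pow_zero, PTrans.maps_one, eq_comm]; rfl
  | succ k ih =>
    rw [pow_succ, PTrans.maps_mul, iterate_succ_apply']
    simp only [ih, maps_iff, exists_eq_left']

/-- The transformation given by an injective function. -/
def ofFun (f : X → X) (hf : Injective f) : InjTrans X :=
  ⟨(f : X →. X), Set.eq_univ_of_forall fun x => ⟨f x, Part.mem_some _⟩, fun _ _ _ hx hy =>
    hf ((Part.mem_some_iff.1 hx).symm.trans (Part.mem_some_iff.1 hy))⟩

theorem toFun_ofFun (f : X → X) (hf : Injective f) : toFun (ofFun f hf) = f :=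
  funext fun _ => maps_iff.1 (Part.mem_some _)

/-- A zero would absorb a transposition on its left, hence identify the two transposed points. -/
theorem not_isZeroElt [Nontrivial X] (z : InjTrans X) : ¬ SemigroupConj.IsZeroElt z := by
  classical
  intro h
  obtain ⟨x, y, hxy⟩ := exists_pair_ne X
  have h1 := congrArg (fun α => (toFun α) x) (h (ofFun (Equiv.swap x y) (Equiv.injective _))).2
  simp only [toFun_mul, toFun_ofFun, Equiv.swap_apply_left] at h1
  exact hxy ((toFun_injective z) h1).symm

theorem exists_mem_conjugatorsOne_iff [Nontrivial X] (α β : InjTrans X) :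
    (∃ g ∈ SemigroupConj.conjugatorsOne α, (α : WithOne (InjTrans X)) * g = g * β) ↔
      SelfMap.Embeds (toFun α) (toFun β) := by
  constructor
  · rintro ⟨g, rfl | ⟨g, -, rfl⟩, h⟩
    · obtain rfl : α = β := WithOne.coe_inj.1 (by simpa using h)
      exact ⟨id, injective_id, Semiconj.id_left⟩
    · have h' : α * g = g * β := WithOne.coe_inj.1 (by simpa using h)
      exact ⟨(toFun g), (toFun_injective g), fun x => by rw [← toFun_mul, h', toFun_mul]⟩
  · rintro ⟨F, hF, hF'⟩
    refine ⟨(ofFun F hF : InjTrans X), Or.inr ⟨ofFun F hF, fun z hz => absurd hz (not_isZeroElt z), rfl⟩, ?_⟩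
    rw [← WithOne.coe_mul, ← WithOne.coe_mul, WithOne.coe_inj]
    exact ext_toFun fun x => by rw [toFun_mul, toFun_mul, toFun_ofFun, hF'.eq]

theorem classOf_eq_iff [Nontrivial X] {α β : InjTrans X} :
    SemigroupConj.classOf α = SemigroupConj.classOf β ↔
      SelfMap.Embeds (toFun α) (toFun β) ∧ SelfMap.Embeds (toFun β) (toFun α) := by
  rw [← exists_mem_conjugatorsOne_iff, ← exists_mem_conjugatorsOne_iff]
  refine (Quotient.eq (r := SemigroupConj.conjSetoid (InjTrans X))).trans ⟨?_, ?_⟩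
  · rintro ⟨g, hg, h, hh, h1, h2⟩
    exact ⟨⟨g, hg, h1⟩, h, hh, h2⟩
  · rintro ⟨⟨g, hg, h1⟩, h, hh, h2⟩
    exact ⟨g, hg, h, hh, h1, h2⟩

theorem isConnected_iff [Nonempty X] {α : InjTrans X} :
    (α : PTrans X).IsConnected ↔ Subsingleton (SelfMap.Component (toFun α)) := by
  have hspan : (α : PTrans X).span = Set.univ := by rw [PTrans.span, α.2.1, Set.univ_union]
  rw [PTrans.IsConnected, hspan, α.2.1, SelfMap.subsingleton_component_iff]
  simp [maps_pow, eq_comm]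

/-! ### Counting the conjugacy classes -/

theorem mk_classes_le (ε : Ordinal.{u}) (hX : #X = aleph ε) :
    #(SemigroupConj.Classes (InjTrans X)) ≤ (ℵ₀ + ε.card) ^ (ℵ₀ : Cardinal.{u}) := by
  have : Infinite X := by rw [infinite_iff, hX]; exact aleph0_le_aleph ε
  let K := CardinalIndex ε
  have hle : ∀ f : X → X, #(SelfMap.Component f) ≤ aleph ε := fun f => hX ▸ mk_quotient_le
  choose a ha using fun (f : X → X) (n : ℕ) => CardinalIndex.exists_val_eq
    ((mk_set_le (SelfMap.componentsOfPeriod f n)).trans (hle f))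
  choose b hb using fun (f : X → X) (n : ℕ) => CardinalIndex.exists_val_eq
    ((mk_set_le (SelfMap.surjComponentsOfPeriod f n)).trans
      ((mk_set_le (SelfMap.componentsOfPeriod f n)).trans (hle f)))
  have hK : #(ℕ → K × K) = (ℵ₀ + ε.card) ^ (ℵ₀ : Cardinal.{u}) := by
    rw [mk_arrow, mk_prod, lift_id, CardinalIndex.mk_eq, mul_eq_self le_self_add]
    simp
  rw [← hK]
  let c : InjTrans X → ℕ → K × K := fun α n => (a (toFun α) n, b (toFun α) n)
  -- The counts are read off a chosen representative, so their invariance within a class is not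
  -- needed.
  refine mk_le_of_injective (f := fun q => c (Quotient.out q)) fun p q hpq => ?_
  have h1 : ∀ n, #(SelfMap.componentsOfPeriod (toFun (Quotient.out p)) n) =
      #(SelfMap.componentsOfPeriod (toFun (Quotient.out q)) n) := fun n => by
    rw [← ha, ← ha]; exact congrArg (fun t => CardinalIndex.val (t n).1) hpq
  have h2 : ∀ n, #(SelfMap.surjComponentsOfPeriod (toFun (Quotient.out p)) n) =
      #(SelfMap.surjComponentsOfPeriod (toFun (Quotient.out q)) n) := fun n => by
    rw [← hb, ← hb]; exact congrArg (fun t => CardinalIndex.val (t n).2) hpq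
  rw [← Quotient.out_eq p, ← Quotient.out_eq q]
  exact classOf_eq_iff.2 ⟨.of_card_components (toFun_injective _) (toFun_injective _) h1 h2,
    .of_card_components (toFun_injective _) (toFun_injective _) (fun n => (h1 n).symm)
      fun n => (h2 n).symm⟩

theorem le_mk_classes (ε : Ordinal.{u}) (hX : #X = aleph ε) :
    (ℵ₀ + ε.card) ^ (ℵ₀ : Cardinal.{u}) ≤ #(SemigroupConj.Classes (InjTrans X)) := by
  have hX' : ℵ₀ ≤ #X := hX ▸ aleph0_le_aleph ε
  have : Infinite X := infinite_iff.2 hX'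
  have hK : #(ℕ → CardinalIndex ε) = (ℵ₀ + ε.card) ^ (ℵ₀ : Cardinal.{u}) := by
    rw [mk_arrow, CardinalIndex.mk_eq]
    simp
  rw [← hK]
  let A : (ℕ → CardinalIndex ε) → ℕ → Type u := fun s n => (s n).val.out
  have e : ∀ s, Nonempty (SelfMap.CyclesAndRays (A s) X ≃ X) := fun s =>
    Cardinal.eq.1 (SelfMap.mk_cyclesAndRays hX' fun n => by
      rw [mk_out, hX]; exact CardinalIndex.val_le _)
  replace e := fun s => (e s).some
  refine mk_le_of_injective (f := fun s => SemigroupConj.classOf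
    (ofFun _ (SelfMap.injective_conj (e s) SelfMap.step_injective))) fun s t hst => ?_
  have key : ∀ s t, SelfMap.Embeds ((e s).conj SelfMap.step) ((e t).conj SelfMap.step) →
      ∀ n : ℕ, (s n).val * (n + 1 : ℕ) ≤ (t n).val * (n + 1 : ℕ) := fun s t h n => by
    have := (((SelfMap.embeds_conj _ _).trans h).trans (SelfMap.conj_embeds _ _)).card_minimalPeriod_le
      (n + 1)
    simpa only [SelfMap.card_minimalPeriod_step, A, mk_out] using this
  obtain ⟨h1, h2⟩ := classOf_eq_iff.1 hst
  rw [toFun_ofFun, toFun_ofFun] at h1 h2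
  -- Periodic points are counted rather than cycles, hence the nonzero finite factor `n + 1` to
  -- cancel.
  exact funext fun n => CardinalIndex.val_injective
    ((mul_natCast_inj n.succ_ne_zero).1 (le_antisymm (key s t h1 n) (key t s h2 n)))

/-! ### Classes with a connected representative -/

theorem mk_connectedClasses_of_countable [Infinite X] [Countable X] : #(connectedClasses X) = 2 := by
  obtain ⟨eN⟩ : Nonempty (ℕ ≃ X) := nonempty_equiv_of_countable
  obtain ⟨eZ⟩ : Nonempty (ℤ ≃ X) := nonempty_equiv_of_countable
  have := SelfMap.subsingleton_component_nat_succ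
  have := SelfMap.subsingleton_component_int_succ
  have hN := SelfMap.subsingleton_component_conj (f := Nat.succ) eN
  have hZ := SelfMap.subsingleton_component_conj (f := fun i : ℤ => i + 1) eZ
  have iN := SelfMap.injective_conj eN Nat.succ_injective
  have iZ := SelfMap.injective_conj eZ (add_left_injective (1 : ℤ))
  -- Surjectivity separates the two models: the successor on `ℕ` misses 0, that on `ℤ` misses
  -- nothing.
  have sN : ¬ Surjective (eN.conj Nat.succ) := fun h => by
    obtain ⟨x, hx⟩ := h (eN 0)
    simp at hx
  have sZ : Surjective (eZ.conj fun i : ℤ => i + 1) := fun x =>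
    ⟨eZ (eZ.symm x - 1), by simp⟩
  have hset : connectedClasses X =
      {SemigroupConj.classOf (ofFun _ iN), SemigroupConj.classOf (ofFun _ iZ)} := by
    ext c
    rw [Set.mem_insert_iff, Set.mem_singleton_iff]
    constructor
    · rintro ⟨α, rfl, hα⟩
      rw [isConnected_iff] at hα
      rw [classOf_eq_iff, classOf_eq_iff, toFun_ofFun, toFun_ofFun]
      by_cases hs : Surjective (toFun α)
      · exact .inr ⟨.of_subsingleton_component (toFun_injective α) iZ fun _ => sZ,
          .of_subsingleton_component iZ (toFun_injective α) fun _ => hs⟩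
      · exact .inl ⟨.of_subsingleton_component (toFun_injective α) iN fun h => absurd h hs,
          .of_subsingleton_component iN (toFun_injective α) fun h => absurd h sN⟩
    · rintro (rfl | rfl)
      · exact ⟨_, rfl, isConnected_iff.2 (by rwa [toFun_ofFun])⟩
      · exact ⟨_, rfl, isConnected_iff.2 (by rwa [toFun_ofFun])⟩
  have hne : SemigroupConj.classOf (ofFun _ iN) ∉
      ({SemigroupConj.classOf (ofFun _ iZ)} : Set (SemigroupConj.Classes (InjTrans X))) := by
    rw [Set.mem_singleton_iff, classOf_eq_iff, toFun_ofFun, toFun_ofFun]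
    exact fun h => sN (h.2.surjective iN sZ)
  rw [hset, mk_insert hne, mk_singleton, one_add_one_eq_two]

theorem mk_connectedClasses_of_uncountable [Uncountable X] : #(connectedClasses X) = 0 := by
  rw [mk_eq_zero_iff]
  refine ⟨?_⟩
  rintro ⟨-, α, -, hα⟩
  rw [isConnected_iff] at hα
  exact not_countable (SelfMap.countable_of_subsingleton_component (toFun_injective α))

end InjTrans

theorem theorem7p9 (X : Type u) (ε : Ordinal.{u}) (hX : #X = Cardinal.aleph ε) :
    #(SemigroupConj.Classes (InjTrans X)) = (ℵ₀ + ε.card) ^ (ℵ₀ : Cardinal.{u}) ∧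
    (Cardinal.aleph ε = ℵ₀ → #(connectedClasses X) = 2) ∧
    (ℵ₀ < Cardinal.aleph ε → #(connectedClasses X) = 0) := by
  have : Infinite X := by rw [infinite_iff, hX]; exact aleph0_le_aleph ε
  refine ⟨le_antisymm (InjTrans.mk_classes_le ε hX) (InjTrans.le_mk_classes ε hX), fun h => ?_,
    fun h => ?_⟩
  · have : Countable X := by rw [← mk_le_aleph0_iff, hX, h]
    exact InjTrans.mk_connectedClasses_of_countable
  · have : Uncountable X := by rwa [← aleph0_lt_mk_iff, hX]
    exact InjTrans.mk_connectedClasses_of_uncountable
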